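/- For an ordinal $\gamma$ let $[0,\gamma]$ be the space of all ordinals $\le\gamma$ with the order topology. For a topological space $X$ let $C_s(X)$ be the set of continuous functions $X\to\mathbb{R}$ with the topology of uniform convergence on the countable (equivalently, separable) subsets of $X$; that is, the sets $\{g\in C(X): |f(x)-g(x)|<\varepsilon \text{ for all } x\in A\}$, with $A\subseteq X$ countable and $\varepsilon>0$, form a neighbourhood base at $f$. A space $Y$ is $\omega_2$-Knaster if every family $\mathcal U$ of nonempty open subsets of $Y$ with $|\mathcal U|=\omega_2$ has a subfamily $\mathcal V$ with $|\mathcal V|=\omega_2$ such that $U\cap V\neq\emptyset$ for all $U,V\in\mathcal V$. The cellularity $c(Y)$ is the least infinite cardinal $\kappa$ such that every family of pairwise disjoint nonempty open subsets of $Y$ has at most $\kappa$ members. (1) Let $n\in\omega$ and let $\gamma_0,\dots,\gamma_n$ be ordinals. Then $C_s\big(\prod_{i\le n}[0,\gamma_i]\big)$, where the product carries the product topology, is $\omega_2$-Knaster. Moreover $c\big(C_s(\prod_{i\le n}[0,\gamma_i])\big)=\omega$ if every $\gamma_i$ is countable, and $c\big(C_s(\prod_{i\le n}[0,\gamma_i])\big)=\omega_1$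 if some $\gamma_i$ is uncountable. (2) Let $X$ be a nonempty compact metrizable space and $\gamma$ an ordinal. Then $C_s([0,\gamma]\times X)$ is $\omega_2$-Knaster. Moreover $c(C_s([0,\gamma]\times X))=\omega$ if $\gamma$ is countable, and $c(C_s([0,\gamma]\times X))=\omega_1$ if $\gamma$ is uncountable. -/

import Mathlib

open scoped Cardinal

universe u v w

noncomputable section

/-- The set `C(X)` of continuous real-valued functions on `X`, wrapped so that it can carry the
topology of pseudouniform convergence rather than the compact-open topology. -/
structure Cs (X : Type w) [TopologicalSpace X] : Type w where
  /-- The underlying continuous function. -/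
  toMap : C(X, ℝ)

/-- The topology of pseudouniform convergence: uniform convergence on the countable subsets of
`X`. -/
instance Cs.instTopologicalSpace (X : Type w) [TopologicalSpace X] : TopologicalSpace (Cs X) :=
  TopologicalSpace.induced
    (fun f : Cs X => UniformOnFun.ofFun {A : Set X | A.Countable} (f.toMap : X → ℝ))
    inferInstance

/-- The sets `V(f, A, ε) = {g | ∀ x ∈ A, |f x - g x| < ε}`, with `A` countable and `ε > 0`, form
a neighbourhood base at `f`. -/
theorem Cs.hasBasis_nhds {X : Type w} [TopologicalSpace X] (f : Cs X) :
    (nhds f).HasBasis (fun p : Set X × ℝ => p.1.Countable ∧ 0 < p.2)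
      (fun p => {g : Cs X | ∀ x ∈ p.1, |f.toMap x - g.toMap x| < p.2}) := by
  have h := (UniformOnFun.hasBasis_nhds_of_basis X ℝ {A : Set X | A.Countable}
    (UniformOnFun.ofFun {A : Set X | A.Countable} (f.toMap : X → ℝ)) ⟨∅, Set.countable_empty⟩
    (fun A hA B hB => ⟨A ∪ B, Set.Countable.union hA hB, Set.subset_union_left,
      Set.subset_union_right⟩) Metric.uniformity_basis_dist).comap
    (fun f : Cs X => UniformOnFun.ofFun {A : Set X | A.Countable} (f.toMap : X → ℝ))
  rw [nhds_induced]
  refine h.congr (fun _ => Iff.rfl) fun p _ => ?_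
  ext g
  simp [UniformOnFun.gen, Real.dist_eq, abs_sub_comm]

/-- `Y` is `κ`-Knaster: every family of size `κ` of nonempty open sets has a subfamily of size `κ`
any two members of which intersect. -/
def IsKnaster (κ : Cardinal.{w}) (Y : Type w) [TopologicalSpace Y] : Prop :=
  ∀ 𝒰 : Set (Set Y), (∀ U ∈ 𝒰, IsOpen U ∧ U.Nonempty) → #𝒰 = κ →
    ∃ 𝒱 : Set (Set Y), 𝒱 ⊆ 𝒰 ∧ #𝒱 = κ ∧ ∀ U ∈ 𝒱, ∀ V ∈ 𝒱, (U ∩ V).Nonempty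

/-- A cellular family: pairwise disjoint nonempty open sets. -/
def IsCellularFamily {Y : Type w} [TopologicalSpace Y] (𝒰 : Set (Set Y)) : Prop :=
  (∀ U ∈ 𝒰, IsOpen U ∧ U.Nonempty) ∧ 𝒰.PairwiseDisjoint id

/-- The cellularity `c(Y)`: the least infinite cardinal that bounds the size of every cellular
family in `Y`. -/
def cellularity (Y : Type w) [TopologicalSpace Y] : Cardinal.{w} :=
  sInf {m : Cardinal.{w} | ℵ₀ ≤ m ∧ ∀ 𝒰 : Set (Set Y), IsCellularFamily 𝒰 → #𝒰 ≤ m}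

end

/-! By compactness, a continuous function on a product of ordinal intervals with `X` is, up to a
small error, a step function: finitely many ordinal cuts together with a code from a countable set
(`exists_step_approx`). Among `ℵ_ 2` basic open sets, `ℵ_ 2` share the code and the radius. The cuts
are then made to agree: a further subfamily of size `ℵ_ 2` has the property that any two members cut
the ordinals common to their countable supports in the same way (`exists_large_compatible`). Two
such centres are close on the intersection of the supports. If the supports are closed, Urysohn's
lemma yields a function in both neighbourhoods (`exists_continuous_eq_and_close`); closing them is
harmless because countable sets of ordinals have countable closures. The Knaster property bounds the
cellularity by `ℵ_ 1`. The bound is attained by the characteristic functions of initial segments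
below `ω₁`; if all the ordinals are countable, the function space is separable. -/

/-! ### Combinatorics of cuts and countable sets -/

theorem mk_iUnion_le_aleph_one {ι : Type v} {α : Type w} (f : ι → Set α) (hι : #ι ≤ ℵ_ 1)
    (hf : ∀ i, #(f i) ≤ ℵ_ 1) : #(⋃ i, f i) ≤ ℵ_ 1 := by
  rw [← Cardinal.lift_le.{v}]
  refine (Cardinal.mk_iUnion_le_lift f).trans ?_
  have h1 : Cardinal.lift.{w} #ι ≤ ℵ_ 1 := by simpa using Cardinal.lift_le.{w}.2 hι
  have h2 : (⨆ i, Cardinal.lift.{v} #(f i)) ≤ ℵ_ 1 :=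
    ciSup_le' fun i => by simpa using Cardinal.lift_le.{v}.2 (hf i)
  refine (mul_le_mul' h1 h2).trans ?_
  rw [Cardinal.mul_eq_self (Cardinal.aleph0_le_aleph 1)]
  simp

theorem lt_aleph_two_iff {c : Cardinal.{w}} : c < ℵ_ 2 ↔ c ≤ ℵ_ 1 := by
  rw [← one_add_one_eq_two, ← Cardinal.succ_aleph, Order.lt_succ_iff]

theorem exists_maximal_pairwise {I : Type w} (R : I → I → Prop) (S : Set I) :
    ∃ M ⊆ S, (∀ α ∈ M, ∀ β ∈ M, R α β) ∧
      ∀ β ∈ S, R β β → (∀ α ∈ M, R α β ∧ R β α) → β ∈ M := by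
  obtain ⟨M, hM⟩ := zorn_subset {M : Set I | M ⊆ S ∧ ∀ α ∈ M, ∀ β ∈ M, R α β} (by
    intro c hc hchain
    refine ⟨⋃₀ c, ⟨Set.sUnion_subset fun s hs => (hc hs).1, ?_⟩,
      fun s hs => Set.subset_sUnion_of_mem hs⟩
    rintro α ⟨s, hs, hα⟩ β ⟨t, ht, hβ⟩
    rcases hchain.total hs ht with h | h
    · exact (hc ht).2 α (h hα) β hβ
    · exact (hc hs).2 α hα β (h hβ))
  refine ⟨M, hM.prop.1, hM.prop.2, fun β hβ hr h => ?_⟩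
  refine hM.le_of_ge (y := insert β M) ⟨Set.insert_subset hβ hM.prop.1, ?_⟩
    (Set.subset_insert _ _) (Set.mem_insert _ _)
  rintro x (rfl | hx) y (rfl | hy)
  · exact hr
  · exact (h y hy).2
  · exact (h x hx).1
  · exact hM.prop.2 x hx y hy

/-- The sets `M ξ`, `ξ < ω₁`, are maximal compatible families chosen ever further up; a `β` above
all of them is incompatible with a member of each, and the witnesses are distinct points of the
countable set `A β`. -/
theorem exists_large_compatible_of_cofinal {I : Type w} {L : Type v} [LinearOrder L]
    (J₀ : Set I) (a : I → L) (A : I → Set L) (hA : ∀ α, (A α).Countable) (δ : L)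
    (hδ : ∀ α ∈ J₀, a α < δ)
    (hcof : ∀ T ⊆ J₀, #T ≤ ℵ_ 1 →
      ∃ β ∈ J₀, β ∉ T ∧ ∀ α ∈ T, ∀ x ∈ A α, x < δ → x < a β) :
    ∃ J ⊆ J₀, ℵ_ 2 ≤ #J ∧
      ∀ α ∈ J, ∀ β ∈ J, ∀ x ∈ A α, x ∈ A β → (x ≤ a α ↔ x ≤ a β) := by
  by_contra! hno
  choose m hmS hmR hmax using
    exists_maximal_pairwise (fun α β => ∀ x ∈ A α, x ∈ A β → (x ≤ a α ↔ x ≤ a β))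
  let W := (Ordinal.omega 1 : Ordinal.{0}).ToType
  have hW : #W = ℵ_ 1 := by simp [W]
  let F : (ξ : W) → ((η : W) → η < ξ → Set I) → Set I := fun ξ M =>
    m {β ∈ J₀ | ∀ η (h : η < ξ), ∀ α ∈ M η h, ∀ x ∈ A α, x < δ → x < a β}
  let M : W → Set I := (wellFounded_lt (α := W)).fix F
  have hM : ∀ ξ, M ξ = m {β ∈ J₀ | ∀ η < ξ, ∀ α ∈ M η, ∀ x ∈ A α, x < δ → x < a β} :=
    fun ξ => WellFounded.fix_eq _ F ξ
  have hMJ : ∀ ξ, M ξ ⊆ J₀ := fun ξ => by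
    rw [hM]; exact (hmS _).trans (Set.sep_subset _ _)
  have hMabove : ∀ ξ, ∀ β ∈ M ξ, ∀ η < ξ, ∀ α ∈ M η, ∀ x ∈ A α, x < δ → x < a β := by
    intro ξ β hβ
    rw [hM] at hβ
    exact (hmS _ hβ).2
  have hcard : #(⋃ ξ, M ξ) ≤ ℵ_ 1 := by
    refine mk_iUnion_le_aleph_one M hW.le fun ξ => lt_aleph_two_iff.1 ?_
    by_contra! h
    obtain ⟨α, hα, β, hβ, x, hx, hx', hne⟩ := hno (M ξ) (hMJ ξ) h
    rw [hM] at hα hβ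
    rcases hne with h | h
    · exact h.2.not_ge ((hmR _ α hα β hβ x hx hx').1 h.1)
    · exact h.1.not_ge ((hmR _ α hα β hβ x hx hx').2 h.2)
  obtain ⟨β, hβJ, hβ, hβabove⟩ := hcof _ (Set.iUnion_subset hMJ) hcard
  -- Since `β` lies above everything relevant, incompatibility with `α` can only occur at a point
  -- `x` with `a α < x ≤ a β`; otherwise maximality would put `β` into `M ξ`.
  have key : ∀ ξ, ∃ α ∈ M ξ, ∃ x ∈ A α, x ∈ A β ∧ a α < x ∧ x < δ := by
    intro ξ
    by_contra! hcon
    refine hβ (Set.mem_iUnion.2 ⟨ξ, ?_⟩)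
    have hagree : ∀ α ∈ M ξ, ∀ x ∈ A α, x ∈ A β → (x ≤ a α ↔ x ≤ a β) := by
      intro α hα x hx hx'
      constructor
      · intro h
        exact (hβabove α (Set.mem_iUnion.2 ⟨ξ, hα⟩) x hx (h.trans_lt (hδ α (hMJ ξ hα)))).le
      · intro h
        by_contra! h'
        exact absurd (h.trans_lt (hδ β hβJ)) (hcon α hα x hx hx' h').not_gt
    rw [hM] at hagree ⊢
    refine hmax _ β ⟨hβJ, fun η _ α hα => hβabove α (Set.mem_iUnion.2 ⟨η, hα⟩)⟩
      (fun _ _ _ => Iff.rfl) fun α hα => ⟨hagree α hα, fun x hx hx' => (hagree α hα x hx' hx).symm⟩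
  choose f hfM x hxf hxβ hfx hxδ using key
  -- For `η < ξ`, `x η < a (f ξ) < x ξ`: the first inequality holds because `M ξ` was chosen above
  -- the points of `M η`.
  have hmono : StrictMono x := fun η ξ h =>
    (hMabove ξ (f ξ) (hfM ξ) η h (f η) (hfM η) (x η) (hxf η) (hxδ η)).trans (hfx ξ)
  have hinj : Function.Injective fun ξ => (⟨x ξ, hxβ ξ⟩ : A β) := fun η ξ h =>
    hmono.injective (congrArg Subtype.val h)
  have : Countable W := by
    have := (hA β).to_subtype
    exact hinj.countable
  have h0 := Cardinal.mk_le_aleph0_iff.2 this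
  rw [hW] at h0
  exact absurd h0 (by simp)

/-- A fibre of `a` of size `ℵ_ 2` is trivially compatible. If there is none, take the least `δ` with
`ℵ_ 2` indices below it: for each `y < δ` at most `ℵ_ 1` indices have `a α ≤ y`, so `ℵ_ 1` many
countable sets cannot exhaust the indices, which is the cofinality hypothesis of the previous lemma.
-/
theorem exists_large_compatible {I : Type w} {L : Type v} [LinearOrder L] [WellFoundedLT L]
    (J₀ : Set I) (hJ₀ : ℵ_ 2 ≤ #J₀) (a : I → L) (A : I → Set L) (hA : ∀ α, (A α).Countable)
    (b : L) (hb : ∀ α, a α < b) :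
    ∃ J ⊆ J₀, ℵ_ 2 ≤ #J ∧
      ∀ α ∈ J, ∀ β ∈ J, ∀ x ∈ A α, x ∈ A β → (x ≤ a α ↔ x ≤ a β) := by
  by_cases hfib : ∃ y, ℵ_ 2 ≤ #{α ∈ J₀ | a α = y}
  · obtain ⟨y, hy⟩ := hfib
    refine ⟨_, Set.sep_subset _ _, hy, ?_⟩
    rintro α ⟨_, hα⟩ β ⟨_, hβ⟩ x _ _
    rw [hα, hβ]
  push Not at hfib
  have hex : ∃ δ, ℵ_ 2 ≤ #{α ∈ J₀ | a α < δ} := ⟨b, by simpa [hb] using hJ₀⟩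
  obtain ⟨δ, hδ, hmin⟩ := WellFounded.has_min (wellFounded_lt (α := L)) _ hex
  obtain ⟨J, hJ, h⟩ := exists_large_compatible_of_cofinal {α ∈ J₀ | a α < δ} a A hA δ
    (fun α hα => hα.2) (by
      intro T _ hTc
      have hlow : ∀ y < δ, #{α ∈ J₀ | a α ≤ y} ≤ ℵ_ 1 := by
        intro y hy
        have h1 : #{α ∈ J₀ | a α < y} ≤ ℵ_ 1 :=
          lt_aleph_two_iff.1 (lt_of_not_ge fun h => hmin y h hy)
        have h2 := lt_aleph_two_iff.1 (hfib y)
        have h3 : {α ∈ J₀ | a α ≤ y} ⊆ {α ∈ J₀ | a α < y} ∪ {α ∈ J₀ | a α = y} := by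
          rintro α ⟨h, h'⟩
          exact h'.lt_or_eq.imp (fun q => ⟨h, q⟩) fun q => ⟨h, q⟩
        exact (Cardinal.mk_le_mk_of_subset h3).trans ((Cardinal.mk_union_le _ _).trans
          (Cardinal.add_le_of_le (Cardinal.aleph0_le_aleph 1) h1 h2))
      have hbad : #(T ∪ ⋃ α : T, ⋃ x : {x ∈ A α | x < δ}, {β ∈ J₀ | a β ≤ x} : Set I) ≤ ℵ_ 1 := by
        refine (Cardinal.mk_union_le _ _).trans
          (Cardinal.add_le_of_le (Cardinal.aleph0_le_aleph 1) hTc ?_)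
        refine mk_iUnion_le_aleph_one _ hTc fun α => mk_iUnion_le_aleph_one _ ?_ fun x =>
          hlow x x.2.2
        exact (Cardinal.le_aleph0_iff_set_countable.2
          ((hA α).mono (Set.sep_subset _ _))).trans (Cardinal.aleph0_le_aleph 1)
      by_contra! hcon
      refine absurd (le_trans hδ (Cardinal.mk_le_mk_of_subset ?_))
        (lt_aleph_two_iff.2 hbad).not_ge
      intro β hβ
      by_cases hβT : β ∈ T
      · exact Or.inl hβT
      obtain ⟨α, hα, x, hx, hxδ, hle⟩ := hcon β hβ hβT
      exact Or.inr (Set.mem_iUnion.2 ⟨⟨α, hα⟩, Set.mem_iUnion.2 ⟨⟨x, hx, hxδ⟩, hβ.1, hle⟩⟩))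
  exact ⟨J, hJ.trans (Set.sep_subset _ _), h⟩

theorem exists_large_compatible_nat {I : Type w} {L : Type v} [LinearOrder L] [WellFoundedLT L]
    (J₀ : Set I) (hJ₀ : ℵ_ 2 ≤ #J₀) (a : I → ℕ → L) (A : I → Set L) (hA : ∀ α, (A α).Countable)
    (b : L) (hb : ∀ α j, a α j < b) (k : ℕ) :
    ∃ J ⊆ J₀, ℵ_ 2 ≤ #J ∧ ∀ α ∈ J, ∀ β ∈ J, ∀ x ∈ A α, x ∈ A β →
      ∀ j < k, (x ≤ a α j ↔ x ≤ a β j) := by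
  induction k with
  | zero => exact ⟨J₀, subset_rfl, hJ₀, by simp⟩
  | succ k ih =>
    obtain ⟨J, hJ, hc, h⟩ := ih
    obtain ⟨J', hJ', hc', h'⟩ := exists_large_compatible J hc (fun α => a α k) A hA b
      fun α => hb α k
    refine ⟨J', hJ'.trans hJ, hc', fun α hα β hβ x hx hx' j hj => ?_⟩
    rcases Nat.lt_succ_iff_lt_or_eq.1 hj with hj | rfl
    · exact h α (hJ' hα) β (hJ' hβ) x hx hx' j hj
    · exact h' α hα β hβ x hx hx'

/-! ### Closures, extensions and compactness for ordinal intervals -/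

/-- Between points `x < y` of the closure there is `b ∈ B` with `x < b ≤ y`. Hence sending `x` to
the least element of `B` above it is injective, and at most one point has none above it. -/
theorem countable_closure_ordinal {B : Set Ordinal.{u}} (hB : B.Countable) :
    (closure B).Countable := by
  have hbetween : ∀ x ∈ closure B, ∀ y < x, ∃ b ∈ B, y < b ∧ b ≤ x := by
    intro x hx y hy
    have ho : IsOpen (Set.Ioo y (Order.succ x)) := isOpen_Ioo
    obtain ⟨b, hb, hbB⟩ := mem_closure_iff.1 hx _ ho ⟨hy, Order.lt_succ x⟩
    exact ⟨b, hbB, hb.1, Order.lt_succ_iff.1 hb.2⟩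
  let S := {x ∈ closure B | ∃ b ∈ B, x < b}
  have hS : S.Countable := by
    choose! φ hφ using fun (x : Ordinal.{u}) (h : ∃ b ∈ B, x < b) =>
      WellFounded.has_min (wellFounded_lt (α := Ordinal.{u})) {b ∈ B | x < b} h
    refine Set.MapsTo.countable_of_injOn (f := φ) (t := B) (fun x hx => (hφ x hx.2).1.1) ?_ hB
    have key : ∀ x ∈ S, ∀ y ∈ S, x < y → φ x ≠ φ y := by
      intro x hx y hy hxy he
      obtain ⟨b, hb, hxb, hby⟩ := hbetween y hy.1 x hxy
      have h1 : φ x ≤ b := not_lt.1 ((hφ x hx.2).2 b ⟨hb, hxb⟩)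
      exact absurd he (h1.trans_lt (hby.trans_lt (hφ y hy.2).1.2)).ne
    intro x hx y hy he
    by_contra hne
    rcases lt_or_gt_of_ne hne with h | h
    · exact key x hx y hy h he
    · exact key y hy x hx h he.symm
  have hsub : (closure B \ S).Subsingleton := by
    intro x hx y hy
    by_contra hne
    rcases lt_or_gt_of_ne hne with h | h
    · obtain ⟨b, hb, h1, _⟩ := hbetween y hy.1 x h
      exact hx.2 ⟨hx.1, b, hb, h1⟩
    · obtain ⟨b, hb, h1, _⟩ := hbetween x hx.1 y h
      exact hy.2 ⟨hy.1, b, hb, h1⟩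
  exact (hS.union hsub.countable).mono fun x hx => by
    by_cases h : x ∈ S
    · exact Or.inl h
    · exact Or.inr ⟨hx, h⟩

theorem exists_continuous_eq_and_close {Z : Type w} [TopologicalSpace Z] [NormalSpace Z]
    (f g : C(Z, ℝ)) {C D : Set Z} (hC : IsClosed C) (hD : IsClosed D) {ε : ℝ} (hε : 0 < ε)
    (h : ∀ z ∈ C, z ∈ D → |f z - g z| < ε) :
    ∃ q : C(Z, ℝ), (∀ z ∈ C, q z = f z) ∧ ∀ z ∈ D, |g z - q z| < ε := by
  have hcl : IsClosed {z | ε ≤ |f z - g z|} := isClosed_le continuous_const (by fun_prop)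
  -- Interpolate from `f` on `C` to `g` on the part of `D` where the two are far apart; elsewhere on
  -- `D` any convex combination is close to `g`.
  obtain ⟨φ, h0, h1, hI⟩ := exists_continuous_zero_one_of_isClosed hC (hD.inter hcl)
    (Set.disjoint_left.2 fun z hz hz' => (h z hz hz'.1).not_ge hz'.2)
  refine ⟨f + φ * (g - f), fun z hz => by simp [h0 hz], fun z hz => ?_⟩
  have he : g z - (f + φ * (g - f)) z = (φ z - 1) * (f z - g z) := by
    simp only [ContinuousMap.add_apply, ContinuousMap.mul_apply, ContinuousMap.sub_apply]; ring
  rw [he, abs_mul]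
  by_cases hz' : ε ≤ |f z - g z|
  · simpa [h1 ⟨hz, hz'⟩] using hε
  · have : |φ z - 1| ≤ 1 := abs_le.2 ⟨by linarith [(hI z).1], by linarith [(hI z).2]⟩
    calc _ ≤ 1 * |f z - g z| := by gcongr
      _ < ε := by rw [one_mul]; exact not_le.1 hz'

instance compactSpace_Iic_ordinal (γ : Ordinal.{u}) : CompactSpace (Set.Iic γ) := by
  rw [← isCompact_iff_compactSpace, ← Set.Icc_bot]
  exact isCompact_Icc

theorem isClopen_Iic_ordinal (c : Ordinal.{u}) : IsClopen (Set.Iic c) :=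
  ⟨isClosed_Iic, by rw [← Order.Iio_succ]; exact isOpen_Iio⟩

/-- The pairs that a given cut does not separate form a closed set, and these sets intersect in the
diagonal, which misses the compact set where `F` varies by at least `ε`. So finitely many cuts
suffice. -/
theorem exists_finset_cuts {n : ℕ} {γ : Fin n → Ordinal.{u}} {b : Ordinal.{u}}
    (hb : ∀ i, γ i < b) {Y : Type v} [PseudoMetricSpace Y] (F : C(∀ i, Set.Iic (γ i), Y))
    {ε : ℝ} (hε : 0 < ε) :
    ∃ s : Finset (Set.Iio b), ∀ p q : ∀ i, Set.Iic (γ i),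
      (∀ c ∈ s, ∀ i, ((p i : Ordinal) ≤ c ↔ (q i : Ordinal) ≤ c)) → dist (F p) (F q) < ε := by
  let K := ∀ i, Set.Iic (γ i)
  let T : Set.Iio b → Set (K × K) := fun c =>
    {z | ∀ i, ((z.1 i : Ordinal) ≤ c ↔ (z.2 i : Ordinal) ≤ c)}
  have hT : ∀ c, IsClosed (T c) := by
    intro c
    simp only [T, Set.ofPred_forall]
    refine isClosed_iInter fun i => ?_
    have h1 : IsClopen {z : K × K | (z.1 i : Ordinal) ≤ c} :=
      (isClopen_Iic_ordinal (c : Ordinal)).preimage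
        (f := fun z : K × K => (z.1 i : Ordinal)) (by fun_prop)
    have h2 : IsClopen {z : K × K | (z.2 i : Ordinal) ≤ c} :=
      (isClopen_Iic_ordinal (c : Ordinal)).preimage
        (f := fun z : K × K => (z.2 i : Ordinal)) (by fun_prop)
    have he : {z : K × K | ((z.1 i : Ordinal) ≤ c ↔ (z.2 i : Ordinal) ≤ c)} =
        ({z : K × K | (z.1 i : Ordinal) ≤ c} ∩ {z : K × K | (z.2 i : Ordinal) ≤ c}) ∪
        ({z : K × K | (z.1 i : Ordinal) ≤ c}ᶜ ∩ {z : K × K | (z.2 i : Ordinal) ≤ c}ᶜ) := by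
      ext z
      simp only [Set.mem_ofPred_eq, Set.mem_union, Set.mem_inter_iff, Set.mem_compl_iff]
      tauto
    rw [he]
    exact ((h1.inter h2).union (h1.compl.inter h2.compl)).isClosed
  have hE : IsCompact {z : K × K | ε ≤ dist (F z.1) (F z.2)} :=
    (isClosed_le continuous_const (by fun_prop)).isCompact
  obtain ⟨s, hs⟩ := hE.elim_finite_subfamily_closed T hT (by
    rw [Set.eq_empty_iff_forall_notMem]
    rintro ⟨p, q⟩ ⟨hd, hz⟩
    have : p = q := by
      funext i
      by_contra hne
      rcases lt_or_gt_of_ne hne with h | h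
      · exact ((Set.mem_iInter.1 hz ⟨p i, (p i).2.trans_lt (hb i)⟩ i).1 le_rfl).not_gt h
      · exact ((Set.mem_iInter.1 hz ⟨q i, (q i).2.trans_lt (hb i)⟩ i).2 le_rfl).not_gt h
    subst this
    simp only [Set.mem_ofPred_eq, dist_self] at hd
    exact hd.not_gt hε)
  refine ⟨s, fun p q h => ?_⟩
  by_contra! hd
  exact Set.eq_empty_iff_forall_notMem.1 hs (p, q) ⟨hd, Set.mem_iInter₂.2 h⟩

/-! ### Step approximation and the Knaster property -/

section
variable {X : Type v} [TopologicalSpace X] [CompactSpace X] [TopologicalSpace.MetrizableSpace X]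

instance separableSpace_continuousMap_real : TopologicalSpace.SeparableSpace C(X, ℝ) := by
  let _ := TopologicalSpace.metrizableSpaceMetric X
  infer_instance

/-- A continuous function on `∏ i, [0, γ i] × X` is uniformly close to one that is determined by
finitely many ordinals `a j` and a code from a countable set. -/
theorem exists_step_approx {n : ℕ} {γ : Fin n → Ordinal.{u}} {b : Ordinal.{u}} (hb0 : 0 < b)
    (hb : ∀ i, γ i < b) (f : C((∀ i, Set.Iic (γ i)) × X, ℝ)) {ε : ℝ} (hε : 0 < ε) :
    ∃ (c : Σ k : ℕ, (Fin n → Fin k → Bool) → ℕ) (a : ℕ → Ordinal.{u}), (∀ j, a j < b) ∧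
      ∀ p x, |f (p, x) - TopologicalSpace.denseSeq C(X, ℝ)
        (c.2 fun i j => decide ((p i : Ordinal) ≤ a j)) x| < ε := by
  classical
  -- One half of `ε` pays for the cuts, the other for replacing a section of `f` by a term of the
  -- dense sequence.
  obtain ⟨s, hs⟩ := exists_finset_cuts hb f.curry (half_pos hε)
  let a : ℕ → Ordinal.{u} := fun j => if h : j < s.card then (s.equivFin.symm ⟨j, h⟩ : Set.Iio b)
    else 0
  let V : (∀ i, Set.Iic (γ i)) → Fin n → Fin s.card → Bool :=
    fun p i j => decide ((p i : Ordinal) ≤ a j)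
  have hcode : ∀ v : Fin n → Fin s.card → Bool, ∃ m : ℕ, ∀ p, V p = v →
      dist (f.curry p) (TopologicalSpace.denseSeq C(X, ℝ) m) < ε := by
    intro v
    by_cases hv : ∃ q, V q = v
    · obtain ⟨q, rfl⟩ := hv
      obtain ⟨m, hm⟩ := (TopologicalSpace.denseRange_denseSeq C(X, ℝ)).exists_dist_lt
        (f.curry q) (half_pos hε)
      refine ⟨m, fun p hp => ?_⟩
      have hpq : dist (f.curry p) (f.curry q) < ε / 2 := by
        refine hs p q fun c hc i => ?_
        have h := congrFun (congrFun hp i) (s.equivFin ⟨c, hc⟩)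
        simpa [V, a] using h
      linarith [dist_triangle (f.curry p) (f.curry q) (TopologicalSpace.denseSeq C(X, ℝ) m)]
    · exact ⟨0, fun p hp => absurd ⟨p, hp⟩ hv⟩
  choose h hh using hcode
  refine ⟨⟨s.card, h⟩, a, fun j => ?_, fun p x => ?_⟩
  · dsimp only [a]
    split_ifs with hj
    · exact (s.equivFin.symm ⟨j, hj⟩ : Set.Iio b).2
    · exact hb0
  · exact (ContinuousMap.dist_apply_le_dist x).trans_lt (hh (V p) p rfl)

theorem isKnaster_Cs {Z : Type w} [TopologicalSpace Z] {n : ℕ} {γ : Fin n → Ordinal.{u}}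
    (e : Z ≃ₜ (∀ i, Set.Iic (γ i)) × X) : IsKnaster (ℵ_ 2) (Cs Z) := by
  intro 𝒰 h𝒰 hcard
  have : CompactSpace Z := e.symm.compactSpace
  have : T2Space Z := e.symm.t2Space
  obtain ⟨b, hb0, hb⟩ : ∃ b : Ordinal.{u}, 0 < b ∧ ∀ i, γ i < b :=
    ⟨Order.succ (⨆ i, γ i), (zero_le).trans_lt (Order.lt_succ _), fun i =>
      Order.lt_succ_iff.2 (le_ciSup (Set.finite_range γ).bddAbove i)⟩
  have hbase : ∀ U : 𝒰, ∃ (f : Cs Z) (A : Set Z) (m : ℕ), A.Countable ∧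
      {g : Cs Z | ∀ z ∈ A, |f.toMap z - g.toMap z| < 1 / ((m : ℝ) + 1)} ⊆ U := by
    intro U
    obtain ⟨hU, f, hf⟩ := h𝒰 U U.2
    obtain ⟨⟨A, ε⟩, ⟨hA, hε⟩, hsub⟩ := (Cs.hasBasis_nhds f).mem_iff.1 (hU.mem_nhds hf)
    obtain ⟨m, hm⟩ := exists_nat_one_div_lt hε
    exact ⟨f, A, m, hA, fun g hg => hsub fun z hz => (hg z hz).trans hm⟩
  choose f A m hA hsub using hbase
  have happ := fun U : 𝒰 => exists_step_approx hb0 hb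
    ((f U).toMap.comp (e.symm : C((∀ i, Set.Iic (γ i)) × X, Z)))
    (ε := 1 / ((m U : ℝ) + 1) / 2) (by positivity)
  choose c a hab hca using happ
  -- All coordinates go into one set of ordinals, so that the combinatorial lemma handles every
  -- coordinate at once.
  let B : 𝒰 → Set Ordinal.{u} := fun U =>
    closure (⋃ i, (fun z => ((e z).1 i : Ordinal.{u})) '' A U)
  have hB : ∀ U, (B U).Countable := fun U =>
    countable_closure_ordinal (Set.countable_iUnion fun i => (hA U).image _)
  let D : 𝒰 → Set Z := fun U => {z | ∀ i, ((e z).1 i : Ordinal.{u}) ∈ B U}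
  have hD : ∀ U, IsClosed (D U) := fun U => by
    simp only [D, Set.ofPred_forall]
    exact isClosed_iInter fun i => isClosed_closure.preimage (by fun_prop)
  have hAD : ∀ U, A U ⊆ D U := fun U z hz i =>
    subset_closure (Set.mem_iUnion.2 ⟨i, z, hz, rfl⟩)
  let κ := (Σ k : ℕ, (Fin n → Fin k → Bool) → ℕ) × ℕ
  -- `ℵ_ 2` is regular and there are only countably many codes and radii.
  obtain ⟨⟨⟨c₀, m₀⟩⟩, hfib⟩ := Cardinal.infinite_pigeonhole_card
    (fun U : 𝒰 => (ULift.up (c U, m U) : ULift.{w} κ)) (ℵ_ 2) hcard.ge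
    (Cardinal.aleph0_le_aleph 2) (by
      rw [← one_add_one_eq_two, (Cardinal.isRegular_aleph_add_one 1).cof_ord]
      exact (Cardinal.mk_le_aleph0).trans_lt (by
        rw [one_add_one_eq_two]
        exact (Cardinal.aleph0_le_aleph 1).trans_lt (Cardinal.aleph_lt_aleph.2 (by simp))))
  obtain ⟨J, hJ, hJc, hJcompat⟩ := exists_large_compatible_nat _ hfib a B hB b hab c₀.1
  have hJc' : ℵ_ 2 ≤ #(Subtype.val '' J : Set (Set (Cs Z))) := by
    rwa [Cardinal.mk_image_eq Subtype.val_injective]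
  obtain ⟨𝒱, h𝒱, h𝒱c⟩ := Cardinal.le_mk_iff_exists_subset.1 hJc'
  refine ⟨𝒱, h𝒱.trans (by rintro _ ⟨U, _, rfl⟩; exact U.2), h𝒱c, fun _ hU' _ hV' => ?_⟩
  obtain ⟨U, hU, rfl⟩ := h𝒱 hU'
  obtain ⟨V, hV, rfl⟩ := h𝒱 hV'
  have hcode : ∀ W ∈ J, c W = c₀ ∧ m W = m₀ := fun W hW =>
    Prod.ext_iff.1 (congrArg ULift.down (hJ hW))
  have hclose : ∀ z ∈ D U, z ∈ D V →
      |(f U).toMap z - (f V).toMap z| < 1 / ((m₀ : ℝ) + 1) := by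
    intro z hzU hzV
    have h1 := hca U (e z).1 (e z).2
    have h2 := hca V (e z).1 (e z).2
    rw [(hcode U hU).1, (hcode U hU).2] at h1
    rw [(hcode V hV).1, (hcode V hV).2] at h2
    have hv : (fun (i : Fin n) (j : Fin c₀.1) => decide (((e z).1 i : Ordinal) ≤ a U j)) =
        fun (i : Fin n) (j : Fin c₀.1) => decide (((e z).1 i : Ordinal) ≤ a V j) := by
      funext i j
      exact decide_eq_decide.2 (hJcompat U hU V hV _ (hzU i) (hzV i) j j.2)
    rw [hv] at h1
    simp only [Prod.mk.eta, ContinuousMap.comp_apply, ContinuousMap.coe_coe,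
      Homeomorph.symm_apply_apply] at h1 h2
    rw [abs_sub_comm] at h2
    refine (abs_sub_le _ _ _).trans_lt ((add_lt_add h1 h2).trans_eq (add_halves _))
  obtain ⟨q, hqU, hqV⟩ := exists_continuous_eq_and_close (f U).toMap (f V).toMap (hD U) (hD V)
    (by positivity) hclose
  refine ⟨⟨q⟩, hsub U fun z hz => ?_, hsub V fun z hz => ?_⟩
  · simp only [hqU z (hAD U hz), sub_self, abs_zero]
    positivity
  · rw [(hcode V hV).2]
    exact hqV z (hAD V hz)

end

/-! ### Cellularity -/

theorem IsKnaster.mk_le_of_isCellularFamily {Y : Type w} [TopologicalSpace Y]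
    (hY : IsKnaster (ℵ_ 2) Y) {𝒰 : Set (Set Y)} (h𝒰 : IsCellularFamily 𝒰) : #𝒰 ≤ ℵ_ 1 := by
  rw [← lt_aleph_two_iff]
  by_contra! h
  obtain ⟨𝒰', hsub, hc⟩ := Cardinal.le_mk_iff_exists_subset.1 h
  obtain ⟨𝒱, h𝒱, h𝒱c, hint⟩ := hY 𝒰' (fun U hU => h𝒰.1 U (hsub hU)) hc
  have : Nontrivial 𝒱 := by
    rw [← Cardinal.one_lt_iff_nontrivial, h𝒱c]
    exact Cardinal.one_lt_aleph0.trans_le (Cardinal.aleph0_le_aleph 2)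
  obtain ⟨U, V, hne⟩ := exists_pair_ne 𝒱
  refine (hint U U.2 V V.2).ne_empty (Set.disjoint_iff_inter_eq_empty.1 ?_)
  exact h𝒰.2 (hsub (h𝒱 U.2)) (hsub (h𝒱 V.2)) fun h => hne (Subtype.ext h)

theorem cellularity_eq_aleph0 {Y : Type w} [TopologicalSpace Y]
    [TopologicalSpace.SeparableSpace Y] : cellularity Y = ℵ₀ := by
  have hmem : ℵ₀ ∈ {m : Cardinal.{w} | ℵ₀ ≤ m ∧
      ∀ 𝒰 : Set (Set Y), IsCellularFamily 𝒰 → #𝒰 ≤ m} :=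
    ⟨le_rfl, fun 𝒰 h => Cardinal.le_aleph0_iff_set_countable.2
      (h.2.countable_of_isOpen (fun U hU => (h.1 U hU).1) fun U hU => (h.1 U hU).2)⟩
  exact le_antisymm (csInf_le' hmem) (le_csInf ⟨_, hmem⟩ fun m hm => hm.1)

theorem cellularity_eq_aleph_one {Y : Type w} [TopologicalSpace Y] (hY : IsKnaster (ℵ_ 2) Y)
    {𝒰 : Set (Set Y)} (h𝒰 : IsCellularFamily 𝒰) (hc : ℵ_ 1 ≤ #𝒰) : cellularity Y = ℵ_ 1 := by
  have hmem : ℵ_ 1 ∈ {m : Cardinal.{w} | ℵ₀ ≤ m ∧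
      ∀ 𝒰 : Set (Set Y), IsCellularFamily 𝒰 → #𝒰 ≤ m} :=
    ⟨Cardinal.aleph0_le_aleph 1, fun 𝒰 h => hY.mk_le_of_isCellularFamily h⟩
  exact le_antisymm (csInf_le' hmem) (le_csInf ⟨_, hmem⟩ fun m hm => hc.trans (hm.2 _ h𝒰))

/-- The norm topology on `C(Z, ℝ)` is finer than that of `Cs Z`, so a dense sequence stays dense. -/
theorem separableSpace_Cs {Z : Type w} [TopologicalSpace Z] [CompactSpace Z]
    [TopologicalSpace.SeparableSpace C(Z, ℝ)] : TopologicalSpace.SeparableSpace (Cs Z) := by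
  have hcont : Continuous (Cs.mk : C(Z, ℝ) → Cs Z) := by
    refine continuous_iff_continuousAt.2 fun f => ?_
    refine (Metric.nhds_basis_ball.tendsto_iff (Cs.hasBasis_nhds (Cs.mk f))).2 ?_
    rintro ⟨A, ε⟩ ⟨_, hε⟩
    refine ⟨ε, hε, fun g hg z _ => ?_⟩
    rw [← Real.dist_eq, dist_comm]
    exact (ContinuousMap.dist_apply_le_dist z).trans_lt hg
  have hsurj : Function.Surjective (Cs.mk : C(Z, ℝ) → Cs Z) := fun f => ⟨f.toMap, rfl⟩
  exact hsurj.denseRange.separableSpace hcont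

theorem secondCountableTopology_of_countable_orderTopology {L : Type w} [LinearOrder L]
    [TopologicalSpace L] [OrderTopology L] [Countable L] : SecondCountableTopology L :=
  ⟨⟨_, ((Set.countable_range Set.Ioi).union (Set.countable_range Set.Iio)), by
    refine OrderTopology.topology_eq_generate_intervals.trans
      (congrArg TopologicalSpace.generateFrom (Set.ext fun s => ⟨?_, ?_⟩))
    · rintro ⟨a, rfl | rfl⟩
      exacts [Or.inl ⟨a, rfl⟩, Or.inr ⟨a, rfl⟩]
    · rintro (⟨a, rfl⟩ | ⟨a, rfl⟩)
      exacts [⟨a, Or.inl rfl⟩, ⟨a, Or.inr rfl⟩]⟩⟩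

theorem countable_Iic_ordinal {γ : Ordinal.{u}} (hγ : γ.card ≤ ℵ₀) : Countable (Set.Iic γ) := by
  rw [← Cardinal.mk_le_aleph0_iff, ← Order.Iio_succ, Cardinal.mk_Iio_ordinal,
    Cardinal.lift_le_aleph0, ← Order.lt_succ_iff, Cardinal.succ_aleph0, ← Cardinal.lt_ord,
    Cardinal.ord_aleph]
  rw [← Order.lt_succ_iff, Cardinal.succ_aleph0, ← Cardinal.lt_ord, Cardinal.ord_aleph] at hγ
  exact (Cardinal.isSuccLimit_omega 1).succ_lt hγ

theorem secondCountableTopology_Iic_ordinal {γ : Ordinal.{u}} (hγ : γ.card ≤ ℵ₀) :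
    SecondCountableTopology (Set.Iic γ) :=
  have := countable_Iic_ordinal hγ
  secondCountableTopology_of_countable_orderTopology

/-- Neighbourhoods of the characteristic functions of the sets `{z | π z ≤ α}`, `α < ω₁`. -/
theorem exists_isCellularFamily_Cs {Z : Type w} [TopologicalSpace Z] {π : Z → Ordinal.{u}}
    (hπ : Continuous π) (hrange : ∀ α < Ordinal.omega 1, ∃ z, π z = α) :
    ∃ 𝒰 : Set (Set (Cs Z)), IsCellularFamily 𝒰 ∧ ℵ_ 1 ≤ #𝒰 := by
  classical
  have : Nonempty Z := (hrange 0 (Ordinal.omega_pos 1)).nonempty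
  choose! σ hσ using hrange
  have hcl : ∀ α, IsClopen {z | π z ≤ α} := fun α =>
    ⟨isClosed_Iic.preimage hπ, by
      simpa [Set.preimage, Order.lt_succ_iff] using (isOpen_Iio (a := Order.succ α)).preimage hπ⟩
  let f : Ordinal.{u} → Cs Z := fun α =>
    ⟨⟨Set.indicator {z | π z ≤ α} 1, (continuous_one).indicator (by simp [(hcl α).frontier_eq])⟩⟩
  -- The successor is included because, for `α < β`, the point over `Order.succ α` has value `0`
  -- under `f α` and `1` under `f β`; radius `1 / 2` then forces disjointness.
  let N : Ordinal.{u} → Set (Cs Z) := fun α =>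
    {g | ∀ z ∈ σ '' Set.Iic (Order.succ α), |(f α).toMap z - g.toMap z| < 1 / 2}
  have hN : ∀ α < Ordinal.omega 1, N α ∈ nhds (f α) := fun α hα => by
    have hα' : Order.succ α < Ordinal.omega 1 := (Cardinal.isSuccLimit_omega 1).succ_lt hα
    refine (Cs.hasBasis_nhds (f α)).mem_of_mem (i := (σ '' Set.Iic (Order.succ α), 1 / 2))
      ⟨Set.Countable.image (Set.countable_coe_iff.1 (countable_Iic_ordinal ?_)) _, by norm_num⟩
    rw [← Order.lt_succ_iff, Cardinal.succ_aleph0, ← Cardinal.lt_ord, Cardinal.ord_aleph]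
    exact hα'
  have hdisj : ∀ α < Ordinal.omega 1, ∀ β < Ordinal.omega 1, α < β → Disjoint (N α) (N β) := by
    intro α hα β hβ hαβ
    have hs : Order.succ α < Ordinal.omega 1 := (Cardinal.isSuccLimit_omega 1).succ_lt hα
    refine Set.disjoint_left.2 fun g h1 h2 => ?_
    have h1 := h1 _ ⟨Order.succ α, Set.mem_Iic.2 le_rfl, rfl⟩
    have h2 := h2 _ ⟨Order.succ α, Order.succ_le_succ hαβ.le, rfl⟩
    have e1 : (f α).toMap (σ (Order.succ α)) = 0 :=
      Set.indicator_of_notMem (s := {z | π z ≤ α}) (fun h => (Order.lt_succ α).not_ge ((hσ _ hs).ge.trans h)) _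
    have e2 : (f β).toMap (σ (Order.succ α)) = 1 :=
      Set.indicator_of_mem (s := {z | π z ≤ β}) ((hσ _ hs).le.trans (Order.succ_le_of_lt hαβ)) _
    rw [e1, abs_lt] at h1
    rw [e2, abs_lt] at h2
    linarith [h1.1, h2.2]
  let G : Set.Iio (Ordinal.omega.{u} 1) → Set (Cs Z) := fun α => interior (N α)
  have hfG : ∀ α, f α ∈ G α := fun α => mem_interior_iff_mem_nhds.2 (hN α α.2)
  have hGdisj : ∀ α β, α ≠ β → Disjoint (G α) (G β) := by
    intro α β hne
    rcases lt_or_gt_of_ne hne with h | h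
    · exact (hdisj α α.2 β β.2 h).mono interior_subset interior_subset
    · exact (hdisj β β.2 α α.2 h).symm.mono interior_subset interior_subset
  have hinj : Function.Injective G := fun α β h => by
    by_contra hne
    exact Set.disjoint_left.1 (hGdisj α β hne) (hfG α) (h ▸ hfG α)
  refine ⟨Set.range G, ⟨?_, ?_⟩, ?_⟩
  · rintro _ ⟨α, rfl⟩
    exact ⟨isOpen_interior, _, hfG α⟩
  · rintro _ ⟨α, rfl⟩ _ ⟨β, rfl⟩ hne
    exact hGdisj α β fun h => hne (congrArg G h)
  · rw [← Cardinal.lift_le.{max (u + 1) w}]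
    have h := Cardinal.mk_range_eq_of_injective hinj
    simp only [Cardinal.mk_Iio_ordinal, Ordinal.card_omega, Cardinal.lift_aleph] at h
    simpa using h.ge

theorem omega_one_le_of_aleph0_lt_card {γ : Ordinal.{u}} (h : ℵ₀ < γ.card) :
    Ordinal.omega 1 ≤ γ := by
  rw [← Cardinal.ord_aleph, Cardinal.ord_le, ← Cardinal.succ_aleph0]
  exact Order.succ_le_of_lt h

/-- All assertions about `C_s` of a space homeomorphic to `∏ i, [0, γ i] × X`. -/
theorem isKnaster_and_cellularity_Cs {Z : Type w} [TopologicalSpace Z] {X : Type v}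
    [TopologicalSpace X] [CompactSpace X] [TopologicalSpace.MetrizableSpace X] [Nonempty X]
    {n : ℕ} {γ : Fin n → Ordinal.{u}} (e : Z ≃ₜ (∀ i, Set.Iic (γ i)) × X) :
    IsKnaster (ℵ_ 2) (Cs Z) ∧
      ((∀ i, (γ i).card ≤ ℵ₀) → cellularity (Cs Z) = ℵ₀) ∧
      ((∃ i, ℵ₀ < (γ i).card) → cellularity (Cs Z) = ℵ_ 1) := by
  refine ⟨isKnaster_Cs e, fun h => ?_, fun ⟨i, hi⟩ => ?_⟩
  · have := fun i => secondCountableTopology_Iic_ordinal (h i)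
    have : SecondCountableTopology X := by
      let _ := TopologicalSpace.metrizableSpaceMetric X
      infer_instance
    have : SecondCountableTopology Z := e.secondCountableTopology
    have : CompactSpace Z := e.symm.compactSpace
    have : T2Space Z := e.symm.t2Space
    have := separableSpace_Cs (Z := Z)
    exact cellularity_eq_aleph0
  · have hπ : Continuous fun z => ((e z).1 i : Ordinal.{u}) := by fun_prop
    obtain ⟨𝒰, h𝒰, hc⟩ := exists_isCellularFamily_Cs hπ fun α hα => by
      obtain ⟨x⟩ := ‹Nonempty X›
      refine ⟨e.symm (Function.update (fun j => ⟨0, Set.mem_Iic.2 zero_le⟩) i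
        ⟨α, hα.le.trans (omega_one_le_of_aleph0_lt_card hi)⟩, x), ?_⟩
      simp
    exact cellularity_eq_aleph_one (isKnaster_Cs e) h𝒰 hc

theorem mainTheorem4 :
    (∀ (n : ℕ) (γ : Fin (n + 1) → Ordinal.{u}),
      IsKnaster (ℵ_ 2) (Cs (∀ i, Set.Iic (γ i))) ∧
      ((∀ i, (γ i).card ≤ ℵ₀) → cellularity (Cs (∀ i, Set.Iic (γ i))) = ℵ₀) ∧
      ((∃ i, ℵ₀ < (γ i).card) → cellularity (Cs (∀ i, Set.Iic (γ i))) = ℵ_ 1)) ∧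
    (∀ (X : Type v) [TopologicalSpace X] [CompactSpace X] [TopologicalSpace.MetrizableSpace X]
      [Nonempty X] (γ : Ordinal.{u}),
      IsKnaster (ℵ_ 2) (Cs (Set.Iic γ × X)) ∧
      (γ.card ≤ ℵ₀ → cellularity (Cs (Set.Iic γ × X)) = ℵ₀) ∧
      (ℵ₀ < γ.card → cellularity (Cs (Set.Iic γ × X)) = ℵ_ 1)) := by
  -- Part (1) takes a one-point space as the metrizable factor; part (2) is a product with a single
  -- ordinal factor.
  refine ⟨fun n γ => isKnaster_and_cellularity_Cs (Homeomorph.prodPUnit.{_, 0} _).symm,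
    fun X _ _ _ _ γ => ?_⟩
  simpa using isKnaster_and_cellularity_Cs (γ := fun _ : Fin 1 => γ)
    ((Homeomorph.funUnique (Fin 1) (Set.Iic γ)).symm.prodCongr (Homeomorph.refl X))
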